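/- Let $n\ge 1$ and let $B_n$ be Artin's braid group with generators $\sigma_1,\dots,\sigma_{n-1}$. Let $\mathscr H_n(z)$ be the Hecke algebra, i.e. the $\mathbf Z[z]$-algebra obtained from the group algebra $\mathbf Z[z][B_n]$ by imposing $\sigma_i-\sigma_i^{-1}=z$ for all $i$, and let $\mathrm{Tr}\colon\mathscr H_n(z)\to\mathbf Z[z,T]$ be Ocneanu's trace, i.e. the unique family (over all $n$) of $\mathbf Z[z]$-linear functionals such that $\mathrm{Tr}(1)=1$, $\mathrm{Tr}(xy)=\mathrm{Tr}(yx)$, $\mathrm{Tr}$ is compatible with the natural maps $\mathscr H_n(z)\to\mathscr H_{n+1}(z)$, and $\mathrm{Tr}(x\sigma_n)=T\,\mathrm{Tr}(x)$ for $x\in\mathscr H_n(z)$. For $x\in\mathscr H_n(z)$ put \[H_x(v,z)=\left(\frac{v^{-1}-v}{z}\right)^{n-1}\mathrm{Tr}(x)\Big|_{T=z/(1-v^2)};\] for (the image in $\mathscr H_n(z)$ of) a braid $\beta\in B_n$ this is the framed Homfly polynomial $H_\beta$. The lower and upper Morton--Franks--Williams (MFW) estimates are \[-n+1\le\text{any exponent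 of }v\text{ in }H_\beta(v,z)\le n-1,\] and the lower (resp. upper) estimate is called sharp for $\beta$ if $-n+1$ is the least (resp. $n-1$ is the greatest) exponent of $v$ in $H_\beta$. Let $x\mapsto x^*$ be the linear extension to $\mathscr H_n(z)$ of the reversal of braid words, and define bilinear forms on $\mathscr H_n(z)$ by \[\langle x,y\rangle_L=z^{n-1}\cdot\bigl[\text{coefficient of }v^{1-n}\text{ in }H_{xy^*}\bigr],\qquad \langle x,y\rangle_R=(-z)^{n-1}\cdot\bigl[\text{coefficient of }v^{n-1}\text{ in }H_{xy^*}\bigr].\] Theorem. For every $n\ge1$ and every braid $\beta\in B_n$, the lower MFW estimate is not sharp for $\beta$ if and only if $\langle\beta,1\rangle_L=0$, and the upper MFW estimate is not sharp for $\beta$ if and only if $\langle\beta,1\rangle_R=0$, where $1$ is the unit braid in the Hecke algebra. -/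

import Mathlib

open Polynomial

namespace BraidHecke

/-! ## Artin's braid group and the Hecke algebra

The variable `z` of the ground ring `ℤ[z]` is `X : ℤ[X]`. -/

/-- The indices `1, …, n - 1` of the generators of the braid group on `n` strands. -/
abbrev Gen (n : ℕ) : Type := {i : ℕ // 0 < i ∧ i < n}

/-- Artin's relators: `σ i σ j (σ j σ i)⁻¹` for `|i - j| ≥ 2`, and
`σ i σ (i+1) σ i (σ (i+1) σ i σ (i+1))⁻¹`. -/
def braidRels (n : ℕ) : Set (FreeGroup (Gen n)) :=
  {r | ∃ i j : Gen n, i.1 + 2 ≤ j.1 ∧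
      r = FreeGroup.of i * FreeGroup.of j * (FreeGroup.of j * FreeGroup.of i)⁻¹} ∪
  {r | ∃ i j : Gen n, i.1 + 1 = j.1 ∧
      r = FreeGroup.of i * FreeGroup.of j * FreeGroup.of i *
        (FreeGroup.of j * FreeGroup.of i * FreeGroup.of j)⁻¹}

/-- Artin's braid group `B_n` on `n` strands. -/
abbrev BraidGroup (n : ℕ) : Type := PresentedGroup (braidRels n)

/-- The standard generator `σ i` of the braid group. -/
def σ {n : ℕ} (i : Gen n) : BraidGroup n := PresentedGroup.of i

theorem σ_comm {n : ℕ} (i j : Gen n) (h : i.1 + 2 ≤ j.1) : σ i * σ j = σ j * σ i :=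
  PresentedGroup.mk_eq_mk_of_mul_inv_mem (Or.inl ⟨i, j, h, rfl⟩)

theorem σ_braid {n : ℕ} (i j : Gen n) (h : i.1 + 1 = j.1) :
    σ i * σ j * σ i = σ j * σ i * σ j :=
  PresentedGroup.mk_eq_mk_of_mul_inv_mem (Or.inr ⟨i, j, h, rfl⟩)

/-- A homomorphism out of the braid group, from images of the generators. -/
def braidLift {n : ℕ} {G : Type*} [Group G] (u : Gen n → G)
    (hc : ∀ i j : Gen n, i.1 + 2 ≤ j.1 → u i * u j = u j * u i)
    (hb : ∀ i j : Gen n, i.1 + 1 = j.1 → u i * u j * u i = u j * u i * u j) :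
    BraidGroup n →* G :=
  PresentedGroup.toGroup (f := u) (by
    rintro r (⟨i, j, h, rfl⟩ | ⟨i, j, h, rfl⟩)
    · simp only [map_mul, map_inv, FreeGroup.lift_apply_of]
      rw [hc i j h, mul_inv_cancel]
    · simp only [map_mul, map_inv, FreeGroup.lift_apply_of]
      rw [hb i j h, mul_inv_cancel])

@[simp] theorem braidLift_σ {n : ℕ} {G : Type*} [Group G] (u : Gen n → G) (hc) (hb)
    (i : Gen n) : braidLift u hc hb (σ i) = u i :=
  PresentedGroup.toGroup.of _

/-- The relations `σ i - (σ i)⁻¹ = z` imposed on the group algebra of the braid group. -/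
inductive HeckeRel (n : ℕ) :
    MonoidAlgebra ℤ[X] (BraidGroup n) → MonoidAlgebra ℤ[X] (BraidGroup n) → Prop
  | skein (i : Gen n) : HeckeRel n
      (MonoidAlgebra.of ℤ[X] (BraidGroup n) (σ i) - MonoidAlgebra.of ℤ[X] (BraidGroup n) (σ i)⁻¹)
      (algebraMap ℤ[X] _ X)

/-- The Hecke algebra `H_n(z)` over `ℤ[z]`: the quotient of the group algebra of the braid group
by the relations `σ i - (σ i)⁻¹ = z`. -/
def HeckeAlgebra (n : ℕ) : Type := RingQuot (HeckeRel n)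

noncomputable instance (n : ℕ) : Ring (HeckeAlgebra n) :=
  inferInstanceAs (Ring (RingQuot (HeckeRel n)))

noncomputable instance (n : ℕ) : Algebra ℤ[X] (HeckeAlgebra n) :=
  inferInstanceAs (Algebra ℤ[X] (RingQuot (HeckeRel n)))

/-- The quotient map from the group algebra of the braid group. -/
noncomputable def quotHecke (n : ℕ) :
    MonoidAlgebra ℤ[X] (BraidGroup n) →ₐ[ℤ[X]] HeckeAlgebra n :=
  RingQuot.mkAlgHom ℤ[X] (HeckeRel n)

/-- The natural representation of braids in the Hecke algebra. -/
noncomputable def toHecke (n : ℕ) : BraidGroup n →* HeckeAlgebra n :=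
  (quotHecke n : MonoidAlgebra ℤ[X] (BraidGroup n) →* HeckeAlgebra n).comp
    (MonoidAlgebra.of ℤ[X] (BraidGroup n))

theorem toHecke_skein {n : ℕ} (i : Gen n) :
    toHecke n (σ i) - toHecke n (σ i)⁻¹ = algebraMap ℤ[X] (HeckeAlgebra n) X := by
  have h : quotHecke n _ = quotHecke n _ := RingQuot.mkAlgHom_rel ℤ[X] (HeckeRel.skein i)
  rw [map_sub, AlgHom.commutes] at h
  exact h

/-- Braids span the Hecke algebra. -/
theorem hecke_induction_braid {n : ℕ} {p : HeckeAlgebra n → Prop} (x : HeckeAlgebra n)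
    (hβ : ∀ β, p (toHecke n β)) (hadd : ∀ x y, p x → p y → p (x + y))
    (hsmul : ∀ (r : ℤ[X]) x, p x → p (r • x)) : p x := by
  obtain ⟨y, rfl⟩ : ∃ y, quotHecke n y = x := RingQuot.mkAlgHom_surjective ℤ[X] (HeckeRel n) x
  induction y using MonoidAlgebra.induction_on with
  | of m => exact hβ m
  | add a b ha hb => rw [map_add]; exact hadd _ _ ha hb
  | smul r a ha => rw [map_smul]; exact hsmul _ _ ha

/-- An algebra homomorphism out of the Hecke algebra, from a representation of the braid group
satisfying the quadratic relations. -/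
noncomputable def heckeLift {n : ℕ} {A : Type*} [Ring A] [Algebra ℤ[X] A]
    (ρ : BraidGroup n →* A) (h : ∀ i, ρ (σ i) - ρ (σ i)⁻¹ = algebraMap ℤ[X] A X) :
    HeckeAlgebra n →ₐ[ℤ[X]] A :=
  RingQuot.liftAlgHom ℤ[X] ⟨MonoidAlgebra.lift ℤ[X] A (BraidGroup n) ρ, by
    rintro _ _ ⟨i⟩
    rw [map_sub, AlgHom.commutes, MonoidAlgebra.lift_of, MonoidAlgebra.lift_of, h i]⟩

@[simp] theorem heckeLift_toHecke {n : ℕ} {A : Type*} [Ring A] [Algebra ℤ[X] A]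
    (ρ : BraidGroup n →* A) (h) (β : BraidGroup n) : heckeLift ρ h (toHecke n β) = ρ β := by
  refine (RingQuot.liftAlgHom_mkAlgHom_apply ℤ[X]
    (MonoidAlgebra.lift ℤ[X] A (BraidGroup n) ρ) _ _).trans ?_
  exact MonoidAlgebra.lift_of _ _

/-- The generator of the Hecke algebra with index `i`, or `0` if the index is out of range. -/
noncomputable def gen (n i : ℕ) : HeckeAlgebra n :=
  if h : 0 < i ∧ i < n then toHecke n (σ ⟨i, h⟩) else 0

theorem toHecke_σ {n : ℕ} (i : Gen n) : toHecke n (σ i) = gen n i.1 := by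
  rw [gen, dif_pos i.2]

theorem toHecke_σ_inv {n : ℕ} (i : Gen n) :
    toHecke n (σ i)⁻¹ = gen n i.1 - algebraMap ℤ[X] _ X := by
  rw [← toHecke_skein i, toHecke_σ, sub_sub_cancel]

theorem gen_sq {n i : ℕ} (h : 0 < i) (h' : i < n) :
    gen n i * gen n i = (X : ℤ[X]) • gen n i + 1 := by
  have h1 : toHecke n (σ ⟨i, h, h'⟩) * toHecke n (σ ⟨i, h, h'⟩)⁻¹ = 1 := by
    rw [← map_mul, mul_inv_cancel, map_one]
  rw [toHecke_σ_inv, toHecke_σ, mul_sub, ← Algebra.commutes, ← Algebra.smul_def] at h1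
  rw [← h1]; abel

theorem gen_comm {n i j : ℕ} (h : i + 2 ≤ j) : gen n i * gen n j = gen n j * gen n i := by
  by_cases hi : 0 < i ∧ i < n
  · by_cases hj : 0 < j ∧ j < n
    · rw [gen, gen, dif_pos hi, dif_pos hj, ← map_mul, ← map_mul, σ_comm _ _ h]
    · simp [gen, dif_neg hj]
  · simp [gen, dif_neg hi]

theorem gen_braid {n i : ℕ} :
    gen n i * gen n (i + 1) * gen n i = gen n (i + 1) * gen n i * gen n (i + 1) := by
  by_cases hi : 0 < i ∧ i < n
  · by_cases hj : 0 < i + 1 ∧ i + 1 < n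
    · rw [gen, gen, dif_pos hi, dif_pos hj]
      simp only [← map_mul]
      rw [σ_braid _ _ rfl]
    · rw [show gen n (i + 1) = 0 from dif_neg hj]; simp
  · simp [gen, dif_neg hi]

/-- The generators generate the Hecke algebra as an algebra. -/
theorem hecke_induction {n : ℕ} {p : HeckeAlgebra n → Prop} (x : HeckeAlgebra n)
    (hr : ∀ r : ℤ[X], p (algebraMap _ _ r)) (hadd : ∀ x y, p x → p y → p (x + y))
    (hmul : ∀ x y, p x → p y → p (x * y)) (hg : ∀ i, 0 < i → i < n → p (gen n i)) : p x := by
  refine hecke_induction_braid x (fun β => ?_) hadd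
    (fun r x hx => by rw [Algebra.smul_def]; exact hmul _ _ (hr r) hx)
  obtain ⟨w, rfl⟩ := PresentedGroup.mk_surjective _ β
  induction w using FreeGroup.induction_on with
  | C1 => rw [map_one, map_one]; simpa using hr 1
  | of i =>
    have := hg i.1 i.2.1 i.2.2
    rw [← toHecke_σ] at this; exact this
  | inv_of i _ =>
    have h := hadd _ _ (hg i.1 i.2.1 i.2.2) (hr (-X))
    rw [map_neg, ← sub_eq_add_neg, ← toHecke_σ_inv] at h
    exact h
  | mul a b ha hb => rw [map_mul, map_mul]; exact hmul _ _ ha hb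

/-- An algebra homomorphism out of the Hecke algebra, from images of the generators satisfying
the quadratic and the braid relations. -/
noncomputable def genLift {n : ℕ} {A : Type*} [Ring A] [Algebra ℤ[X] A] (u : ℕ → A)
    (hq : ∀ i, 0 < i → i < n → u i * u i = (X : ℤ[X]) • u i + 1)
    (hc : ∀ i j, 0 < i → j < n → i + 2 ≤ j → u i * u j = u j * u i)
    (hb : ∀ i, 0 < i → i + 1 < n → u i * u (i + 1) * u i = u (i + 1) * u i * u (i + 1)) :
    HeckeAlgebra n →ₐ[ℤ[X]] A :=
  let U : Gen n → Aˣ := fun i =>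
    { val := u i.1
      inv := u i.1 - algebraMap ℤ[X] A X
      val_inv := by
        rw [mul_sub, hq _ i.2.1 i.2.2, ← Algebra.commutes, ← Algebra.smul_def, add_sub_cancel_left]
      inv_val := by
        rw [sub_mul, hq _ i.2.1 i.2.2, ← Algebra.smul_def, add_sub_cancel_left] }
  heckeLift ((Units.coeHom A).comp (braidLift U
      (fun i j h => Units.ext (hc _ _ i.2.1 j.2.2 h))
      (by
        rintro ⟨i, hi⟩ ⟨j, hj⟩ h
        obtain rfl : i + 1 = j := h
        exact Units.ext (hb _ hi.1 hj.2))))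
    (fun i => by
      rw [MonoidHom.comp_apply, MonoidHom.comp_apply, map_inv]
      simp only [Units.coeHom_apply, braidLift_σ]
      exact sub_sub_cancel (u i.1) _)

theorem genLift_gen {n : ℕ} {A : Type*} [Ring A] [Algebra ℤ[X] A] (u : ℕ → A) (hq) (hc) (hb)
    {i : ℕ} (h : 0 < i) (h' : i < n) : genLift (n := n) u hq hc hb (gen n i) = u i := by
  rw [gen, dif_pos ⟨h, h'⟩, genLift, heckeLift_toHecke]
  simp

/-- The natural homomorphism from `H_n(z)` to `H_{n+1}(z)`, adding an unused last strand. -/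
noncomputable def incl (n : ℕ) : HeckeAlgebra n →ₐ[ℤ[X]] HeckeAlgebra (n + 1) :=
  genLift (gen (n + 1)) (fun _ h h' => gen_sq h (by omega)) (fun _ _ _ _ h => gen_comm h)
    (fun _ _ _ => gen_braid)

theorem incl_gen {n i : ℕ} (h : i < n) : incl n (gen n i) = gen (n + 1) i := by
  rcases Nat.eq_zero_or_pos i with rfl | h0
  · simp [gen]
  · exact genLift_gen _ _ _ _ h0 h

/-! ## The action on cosets

`H_{n+1}(z)` is a free right `H_n(z)`-module on `m_k = σ (k+1) σ (k+2) ⋯ σ n`, `0 ≤ k ≤ n`.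
An element `∑ m_k f_k` is recorded by its coordinates `f : Fin (n+1) → H_n(z)`. -/

/-- Left multiplication by `σ j`, `1 ≤ j ≤ n`, in the coordinates `f`. -/
noncomputable def genAct (n : ℕ) (j : ℕ) : Module.End ℤ[X] (Fin (n + 1) → HeckeAlgebra n) where
  toFun f l :=
    if l.1 + 1 < j then gen n (j - 1) * f l
    else if l.1 + 1 = j then (X : ℤ[X]) • f l + f (Fin.ofNat (n + 1) j)
    else if l.1 = j then f (Fin.ofNat (n + 1) (j - 1))
    else gen n j * f l
  map_add' f g := by
    funext l; simp only [Pi.add_apply]; split_ifs <;> simp only [mul_add, smul_add]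
    abel
  map_smul' r f := by
    funext l; simp only [Pi.smul_apply, RingHom.id_apply]
    split_ifs <;> simp only [mul_smul_comm, smul_add, smul_comm r]

section
variable {n j l : ℕ} (f : Fin (n + 1) → HeckeAlgebra n)

theorem genAct_lt (hl : l < n + 1) (h : l + 1 < j) :
    genAct n j f ⟨l, hl⟩ = gen n (j - 1) * f ⟨l, hl⟩ := by simp [genAct, h]

theorem genAct_pred (hl : l < n + 1) (hl' : l + 1 < n + 1) :
    genAct n (l + 1) f ⟨l, hl⟩ = (X : ℤ[X]) • f ⟨l, hl⟩ + f ⟨l + 1, hl'⟩ := by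
  simp [genAct, Fin.ofNat, Nat.mod_eq_of_lt hl']

theorem genAct_self (hl : l < n + 1) (hl' : l + 1 < n + 1) :
    genAct n (l + 1) f ⟨l + 1, hl'⟩ = f ⟨l, hl⟩ := by
  simp [genAct, Fin.ofNat, Nat.mod_eq_of_lt hl]

theorem genAct_gt (hl : l < n + 1) (h : j < l) :
    genAct n j f ⟨l, hl⟩ = gen n j * f ⟨l, hl⟩ := by
  simp only [genAct, LinearMap.coe_mk, AddHom.coe_mk]
  rw [if_neg (by omega), if_neg (by omega), if_neg (by omega)]

end

theorem genAct_sq {n j : ℕ} (h : 0 < j) (h' : j < n + 1) :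
    genAct n j * genAct n j = (X : ℤ[X]) • genAct n j + 1 := by
  obtain ⟨j, rfl⟩ : ∃ i, j = i + 1 := ⟨j - 1, by omega⟩
  refine LinearMap.ext fun f => funext fun ⟨l, hl⟩ => ?_
  simp only [Module.End.mul_apply, LinearMap.add_apply, LinearMap.smul_apply, Pi.add_apply,
    Pi.smul_apply, Module.End.one_apply]
  rcases lt_trichotomy l j with hlj | rfl | hlj
  · rw [genAct_lt _ hl (by omega), genAct_lt _ hl (by omega), ← mul_assoc,
      gen_sq (by omega) (by omega), add_mul, one_mul, smul_mul_assoc]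
  · rw [genAct_pred _ hl h', genAct_pred _ hl h', genAct_self _ hl h']
  · rcases Nat.lt_or_ge (j + 1) l with h1 | h1
    · rw [genAct_gt _ hl (by omega), genAct_gt _ hl (by omega), ← mul_assoc,
        gen_sq (by omega) (by omega), add_mul, one_mul, smul_mul_assoc]
    · obtain rfl : l = j + 1 := by omega
      rw [genAct_self _ (by omega) hl, genAct_pred _ (by omega) hl, genAct_self _ (by omega) hl]

theorem genAct_comm {n i j : ℕ} (h : 0 < i) (h' : j < n + 1) (hij : i + 2 ≤ j) :
    genAct n i * genAct n j = genAct n j * genAct n i := by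
  obtain ⟨i, rfl⟩ : ∃ k, i = k + 1 := ⟨i - 1, by omega⟩
  obtain ⟨j, rfl⟩ : ∃ k, j = k + 1 := ⟨j - 1, by omega⟩
  refine LinearMap.ext fun f => funext fun ⟨l, hl⟩ => ?_
  simp only [Module.End.mul_apply]
  have hi : i + 1 < n + 1 := by omega
  rcases lt_trichotomy l i with h1 | rfl | h1
  · rw [genAct_lt _ hl (by omega), genAct_lt _ hl (by omega), genAct_lt _ hl (by omega),
      genAct_lt _ hl (by omega), ← mul_assoc, ← mul_assoc, gen_comm (by omega)]
  · rw [genAct_pred _ hl hi, genAct_lt _ hl (by omega), genAct_lt _ hi (by omega),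
      genAct_lt _ hl (by omega), genAct_pred _ hl hi, mul_add, mul_smul_comm]
  · rcases Nat.lt_or_ge (i + 1) l with h2 | h2
    · rcases lt_trichotomy l j with h3 | rfl | h3
      · rw [genAct_gt _ hl h2, genAct_lt _ hl (by omega), genAct_lt _ hl (by omega),
          genAct_gt _ hl h2, ← mul_assoc, ← mul_assoc, gen_comm (by omega)]
      · rw [genAct_gt _ hl h2, genAct_pred _ hl h', genAct_pred _ hl h', genAct_gt _ hl h2,
          genAct_gt _ h' (by omega), mul_add, mul_smul_comm]
      · rcases Nat.lt_or_ge (j + 1) l with h4 | h4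
        · rw [genAct_gt _ hl h2, genAct_gt _ hl h4, genAct_gt _ hl h4, genAct_gt _ hl h2,
            ← mul_assoc, ← mul_assoc, gen_comm (by omega)]
        · obtain rfl : l = j + 1 := by omega
          rw [genAct_gt _ hl h2, genAct_self _ (by omega) hl, genAct_self _ (by omega) hl,
            genAct_gt _ _ (by omega)]
    · obtain rfl : l = i + 1 := by omega
      rw [genAct_self _ (by omega) hl, genAct_lt _ _ (by omega), genAct_lt _ hl (by omega),
        genAct_self _ (by omega) hl]

theorem genAct_braid {n i : ℕ} (h : 0 < i) (h' : i + 1 < n + 1) :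
    genAct n i * genAct n (i + 1) * genAct n i =
      genAct n (i + 1) * genAct n i * genAct n (i + 1) := by
  obtain ⟨i, rfl⟩ : ∃ k, i = k + 1 := ⟨i - 1, by omega⟩
  refine LinearMap.ext fun f => funext fun ⟨l, hl⟩ => ?_
  simp only [Module.End.mul_apply]
  have h0 : i < n + 1 := by omega
  have h1 : i + 1 < n + 1 := by omega
  rcases lt_trichotomy l i with h2 | rfl | h2
  · obtain ⟨i, rfl⟩ : ∃ k, i = k + 1 := ⟨i - 1, by omega⟩
    rw [genAct_lt _ hl (by omega), genAct_lt _ hl (by omega), genAct_lt _ hl (by omega),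
      genAct_lt _ hl (by omega), genAct_lt _ hl (by omega), genAct_lt _ hl (by omega)]
    simp only [← mul_assoc]
    exact congrArg (· * f ⟨l, hl⟩) gen_braid
  · rw [genAct_pred _ hl h1, genAct_lt _ hl (by omega), genAct_pred _ hl h1, genAct_pred _ h1 h',
      genAct_self _ h0 h1, genAct_gt _ h' (by omega), genAct_lt _ hl (by omega),
      genAct_pred _ hl h1, genAct_lt _ hl (by omega), genAct_pred _ h1 h']
    simp only [Nat.add_sub_cancel]
    simp only [mul_add, mul_smul_comm, smul_add]
    rw [← mul_assoc, gen_sq (by omega) (by omega), add_mul, one_mul, smul_mul_assoc, smul_add]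
    abel
  · rcases Nat.lt_or_ge (i + 1 + 1) l with h3 | h3
    · rw [genAct_gt _ hl (by omega), genAct_gt _ hl (by omega), genAct_gt _ hl (by omega),
        genAct_gt _ hl (by omega), genAct_gt _ hl (by omega), genAct_gt _ hl (by omega)]
      simp only [← mul_assoc]
      rw [gen_braid]
    · rcases Nat.lt_or_ge (i + 1) l with h4 | h4
      · obtain rfl : l = i + 1 + 1 := by omega
        rw [genAct_gt _ hl (by omega), genAct_self _ h1 hl, genAct_self _ h0 h1,
          genAct_self _ h1 hl, genAct_self _ h0 h1, genAct_lt _ h0 (by omega)]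
        simp
      · obtain rfl : l = i + 1 := by omega
        rw [genAct_self _ h0 h1, genAct_lt _ h0 (by omega), genAct_pred _ h0 h1,
          genAct_pred _ h1 h', genAct_self _ h0 h1, genAct_gt _ h' (by omega),
          genAct_lt _ h0 (by omega), genAct_self _ h1 h']
        simp only [Nat.add_sub_cancel]
        rw [mul_add, mul_smul_comm]

/-- The left action of `H_{n+1}(z)` on coordinate vectors. -/
noncomputable def cosetRep (n : ℕ) :
    HeckeAlgebra (n + 1) →ₐ[ℤ[X]] Module.End ℤ[X] (Fin (n + 1) → HeckeAlgebra n) :=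
  genLift (genAct n) (fun _ => genAct_sq) (fun _ _ => genAct_comm) (fun _ => genAct_braid)

theorem cosetRep_gen {n j : ℕ} (h : 0 < j) (h' : j < n + 1) :
    cosetRep n (gen (n + 1) j) = genAct n j :=
  genLift_gen _ _ _ _ h h'

/-- The coordinates of `x ∈ H_{n+1}(z)`, obtained by letting `x` act on `1 = m_n`. -/
noncomputable def cosetCoord (n : ℕ) :
    HeckeAlgebra (n + 1) →ₗ[ℤ[X]] (Fin (n + 1) → HeckeAlgebra n) :=
  LinearMap.applyₗ (Pi.single (Fin.last n) 1) ∘ₗ (cosetRep n).toLinearMap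

/-- The product `σ (k+1) σ (k+2) ⋯ σ (n-1)` in `H_n(z)`; it is `1` for `k ≥ n - 1`. -/
noncomputable def chain (n k : ℕ) : HeckeAlgebra n :=
  ((List.Ico (k + 1) n).map (gen n)).prod

/-! ## Ocneanu's trace

Writing `x ∈ H_{n+1}(z)` as `∑ m_k f_k`, the rules `Tr (a σ n b) = T Tr (a b)` and `Tr a = Tr a`
for `a b ∈ H_n(z)` give `Tr x = Tr f_n + T ∑_{k < n} Tr (σ (k+1) ⋯ σ (n-1) f_k)`. -/

/-- The `T`-free part of the partial trace `H_{n+1}(z) → H_n(z)[T]`. -/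
noncomputable def partialTrace₀ (n : ℕ) : HeckeAlgebra (n + 1) →ₗ[ℤ[X]] HeckeAlgebra n :=
  LinearMap.proj (Fin.last n) ∘ₗ cosetCoord n

/-- The coefficient of `T` in the partial trace `H_{n+1}(z) → H_n(z)[T]`. -/
noncomputable def partialTrace₁ (n : ℕ) : HeckeAlgebra (n + 1) →ₗ[ℤ[X]] HeckeAlgebra n :=
  (∑ k : Fin n, LinearMap.mulLeft ℤ[X] (chain n k) ∘ₗ LinearMap.proj k.castSucc) ∘ₗ cosetCoord n

/-- Ocneanu's trace `Tr : H_n(z) → ℤ[z][T]`, where `T` is the outer polynomial variable. -/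
noncomputable def ocneanuTrace : (n : ℕ) → HeckeAlgebra n →ₗ[ℤ[X]] ℤ[X][X]
  | 0 => (genLift (fun _ => 1) (fun _ _ h => by omega) (fun _ _ _ _ _ => rfl)
      (fun _ _ _ => rfl) : HeckeAlgebra 0 →ₐ[ℤ[X]] ℤ[X][X]).toLinearMap
  | n + 1 => ocneanuTrace n ∘ₗ partialTrace₀ n +
      LinearMap.mulLeft ℤ[X] (X : ℤ[X][X]) ∘ₗ ocneanuTrace n ∘ₗ partialTrace₁ n

/-! ## The characteristic properties of Ocneanu's trace -/

theorem chain_step {N k : ℕ} (h : k + 1 < N) :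
    chain N k = gen N (k + 1) * chain N (k + 1) := by
  rw [chain, List.Ico.eq_cons h, List.map_cons, List.prod_cons, chain]

theorem chain_top {N k : ℕ} (h : N ≤ k + 1) : chain N k = 1 := by
  rw [chain, List.Ico.eq_nil_of_le h, List.map_nil, List.prod_nil]

theorem gen_chain_gt {N i k : ℕ} (h : i < k) : gen N i * chain N k = chain N k * gen N i := by
  refine Commute.list_prod_right _ _ fun x hx => ?_
  obtain ⟨m, hm, rfl⟩ := List.mem_map.1 hx
  have := (List.Ico.mem.1 hm).1
  exact gen_comm (by omega)

theorem gen_chain_lt {N i k : ℕ} (h : k < i) (hi : i + 1 < N) :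
    gen N (i + 1) * chain N k = chain N k * gen N i := by
  obtain ⟨d, rfl⟩ : ∃ d, i = k + 1 + d := ⟨i - (k + 1), by omega⟩
  clear h
  induction d generalizing k with
  | zero =>
    rw [chain_step (k := k) (by omega), chain_step (k := k + 1) (by omega)]
    simp only [Nat.add_zero]
    rw [← mul_assoc, ← mul_assoc, ← gen_braid, mul_assoc _ (gen N (k + 1)),
      gen_chain_gt (by omega)]
    simp only [mul_assoc]
  | succ d ih =>
    rw [chain_step (k := k) (by omega), ← mul_assoc, ← gen_comm (by omega), mul_assoc, mul_assoc]
    have := ih (k := k + 1) (by omega)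
    rw [show k + 1 + (d + 1) = k + 1 + 1 + d by omega, this]

theorem sum_genAct {n i : ℕ} {A : Type*} [Ring A] [Algebra ℤ[X] A] (φ : HeckeAlgebra n →ₐ[ℤ[X]] A)
    (c : ℕ → A) (s : A) (hi : i + 1 < n + 1) (h1 : s * c (i + 1) = c i)
    (h2 : s * c i = (X : ℤ[X]) • c i + c (i + 1))
    (h3 : ∀ k, i + 1 < k → k ≤ n → s * c k = c k * φ (gen n (i + 1)))
    (h4 : ∀ k, k < i → s * c k = c k * φ (gen n i)) (f : Fin (n + 1) → HeckeAlgebra n) :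
    ∑ k : Fin (n + 1), c k * φ (genAct n (i + 1) f k) = s * ∑ k : Fin (n + 1), c k * φ (f k) := by
  have hi0 : i < n + 1 := by omega
  have key : ∀ F : Fin (n + 1) → A, ∑ k, F k = F ⟨i, hi0⟩ + F ⟨i + 1, hi⟩ +
      ∑ k ∈ (Finset.univ.erase (⟨i, hi0⟩ : Fin (n + 1))).erase ⟨i + 1, hi⟩, F k := fun F => by
    rw [add_assoc, Finset.add_sum_erase _ _ (by simp), Finset.add_sum_erase _ _ (by simp)]
  rw [Finset.mul_sum, key, key]
  congr 1
  · rw [genAct_pred f hi0 hi, genAct_self f hi0 hi, map_add, map_smul, ← mul_assoc, ← mul_assoc,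
      h1, h2, add_mul, mul_add, mul_smul_comm, smul_mul_assoc]
    abel
  · refine Finset.sum_congr rfl fun ⟨k, hk⟩ hmem => ?_
    simp only [Finset.mem_erase, ne_eq, Fin.mk.injEq, Finset.mem_univ, and_true] at hmem
    rcases lt_trichotomy k i with h | h | h
    · rw [genAct_lt f hk (by omega), map_mul, ← mul_assoc, ← mul_assoc, h4 k h]
      rfl
    · omega
    · rw [genAct_gt f hk (by omega), map_mul, ← mul_assoc, ← mul_assoc,
        h3 k (by omega) (by omega)]

theorem cosetRep_mul_right {n : ℕ} (x : HeckeAlgebra (n + 1)) (b : HeckeAlgebra n)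
    (f : Fin (n + 1) → HeckeAlgebra n) :
    cosetRep n x (fun k => f k * b) = fun k => cosetRep n x f k * b := by
  induction x using hecke_induction generalizing f with
  | hr r => simp only [AlgHom.commutes, Module.algebraMap_end_apply]
            funext k; simp only [Pi.smul_apply, smul_mul_assoc]
  | hadd x y hx hy => simp only [map_add, LinearMap.add_apply, hx, hy]
                      funext k; simp only [Pi.add_apply, add_mul]
  | hmul x y hx hy => simp only [map_mul, Module.End.mul_apply, hx, hy]
  | hg i h h' =>
    rw [cosetRep_gen h h']
    funext k
    simp only [genAct, LinearMap.coe_mk, AddHom.coe_mk]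
    split_ifs <;> simp only [add_mul, smul_mul_assoc, mul_assoc]

theorem cosetRep_incl {n : ℕ} (a y : HeckeAlgebra n) :
    cosetRep n (incl n a) (Pi.single (Fin.last n) y) = Pi.single (Fin.last n) (a * y) := by
  induction a using hecke_induction generalizing y with
  | hr r => rw [AlgHom.commutes, AlgHom.commutes, Module.algebraMap_end_apply, ← Algebra.smul_def,
              Pi.single_smul]
  | hadd a b ha hb => rw [map_add, map_add, LinearMap.add_apply, ha, hb, add_mul, Pi.single_add]
  | hmul a b ha hb => rw [map_mul, map_mul, Module.End.mul_apply, hb, ha, mul_assoc]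
  | hg i h h' =>
    rw [incl_gen h', cosetRep_gen h (by omega)]
    obtain ⟨i, rfl⟩ : ∃ k, i = k + 1 := ⟨i - 1, by omega⟩
    have h0 : ∀ l (hl : l < n + 1) (z : HeckeAlgebra n), l ≠ n →
        (Pi.single (Fin.last n) z : Fin (n + 1) → HeckeAlgebra n) ⟨l, hl⟩ = 0 :=
      fun l hl z hne => Pi.single_eq_of_ne (by simpa [Fin.ext_iff] using hne) _
    funext ⟨l, hl⟩
    rcases lt_trichotomy l i with h1 | rfl | h1
    · rw [genAct_lt _ hl (by omega), h0 _ _ _ (by omega), h0 _ _ _ (by omega), mul_zero]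
    · rw [genAct_pred _ hl (by omega), h0 _ _ _ (by omega), h0 _ _ _ (by omega),
        h0 _ _ _ (by omega), smul_zero, add_zero]
    · rcases Nat.lt_or_ge (i + 1) l with h2 | h2
      · rw [genAct_gt _ hl h2]
        rcases eq_or_ne l n with rfl | h3
        · change _ * (Pi.single (Fin.last l) y : Fin (l + 1) → _) (Fin.last l) =
            (Pi.single (Fin.last l) _ : Fin (l + 1) → _) (Fin.last l)
          rw [Pi.single_eq_same, Pi.single_eq_same]
        · rw [h0 _ _ _ h3, h0 _ _ _ h3, mul_zero]
      · obtain rfl : l = i + 1 := by omega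
        rw [genAct_self _ (by omega) hl, h0 _ _ _ (by omega), h0 _ _ _ (by omega)]

theorem cosetCoord_mul {n : ℕ} (x y : HeckeAlgebra (n + 1)) :
    cosetCoord n (x * y) = cosetRep n x (cosetCoord n y) := by
  simp [cosetCoord]

theorem cosetCoord_incl {n : ℕ} (a : HeckeAlgebra n) :
    cosetCoord n (incl n a) = Pi.single (Fin.last n) a := by
  simp [cosetCoord, cosetRep_incl]

theorem cosetCoord_mul_incl {n : ℕ} (x : HeckeAlgebra (n + 1)) (b : HeckeAlgebra n) :
    cosetCoord n (x * incl n b) = fun k => cosetCoord n x k * b := by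
  have h : (Pi.single (Fin.last n) b : Fin (n + 1) → HeckeAlgebra n) =
      fun k => (Pi.single (Fin.last n) 1 : Fin (n + 1) → HeckeAlgebra n) k * b := by
    funext k
    rcases eq_or_ne k (Fin.last n) with rfl | hk
    · simp
    · rw [Pi.single_eq_of_ne hk, Pi.single_eq_of_ne hk, zero_mul]
  rw [cosetCoord_mul, cosetCoord_incl, h, cosetRep_mul_right]
  rfl

theorem cosetCoord_gen (n : ℕ) :
    cosetCoord (n + 1) (gen (n + 2) (n + 1)) = Pi.single (Fin.last n).castSucc 1 := by
  change cosetRep (n + 1) _ _ = _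
  rw [cosetRep_gen (by omega) (by omega)]
  funext ⟨l, hl⟩
  rcases lt_trichotomy l n with h1 | rfl | h1
  · rw [genAct_lt _ hl (by omega), Pi.single_eq_of_ne, Pi.single_eq_of_ne, mul_zero] <;>
      simp [Fin.ext_iff] <;> omega
  · rw [genAct_pred _ hl (by omega), Pi.single_eq_of_ne]
    · change _ + (Pi.single (Fin.last (l + 1)) 1 : Fin (l + 2) → _) (Fin.last (l + 1)) =
        (Pi.single (Fin.last l).castSucc 1 : Fin (l + 2) → _) (Fin.last l).castSucc
      rw [Pi.single_eq_same, Pi.single_eq_same, smul_zero, zero_add]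
    · simp [Fin.ext_iff]
  · obtain rfl : l = n + 1 := by omega
    rw [genAct_self _ (by omega) hl, Pi.single_eq_of_ne, Pi.single_eq_of_ne] <;>
      simp [Fin.ext_iff]

theorem eq_sum_cosetCoord {n : ℕ} (x : HeckeAlgebra (n + 1)) :
    x = ∑ k : Fin (n + 1), chain (n + 1) k * incl n (cosetCoord n x k) := by
  have key : ∀ (x : HeckeAlgebra (n + 1)) f,
      ∑ k : Fin (n + 1), chain (n + 1) k * incl n (cosetRep n x f k) =
        x * ∑ k : Fin (n + 1), chain (n + 1) k * incl n (f k) := by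
    intro x
    induction x using hecke_induction with
    | hr r =>
      intro f
      simp only [AlgHom.commutes, Module.algebraMap_end_apply, Pi.smul_apply, map_smul,
        mul_smul_comm, ← Finset.smul_sum, ← Algebra.smul_def]
    | hadd x y hx hy =>
      intro f
      simp only [map_add, LinearMap.add_apply, Pi.add_apply, mul_add, Finset.sum_add_distrib,
        hx, hy, add_mul]
    | hmul x y hx hy =>
      intro f
      simp only [map_mul, Module.End.mul_apply, hx, hy, mul_assoc]
    | hg i h h' =>
      intro f
      obtain ⟨i, rfl⟩ : ∃ k, i = k + 1 := ⟨i - 1, by omega⟩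
      rw [cosetRep_gen h h']
      refine sum_genAct (incl n) (chain (n + 1)) _ h' (chain_step h').symm ?_ ?_ ?_ f
      · rw [chain_step h', ← mul_assoc, gen_sq h h', add_mul, one_mul, smul_mul_assoc]
      · intro k hk hk'
        rw [incl_gen (by omega), gen_chain_gt hk]
      · intro k hk
        rw [incl_gen (by omega), gen_chain_lt hk h']
  have h := key x (Pi.single (Fin.last n) 1)
  rw [Finset.sum_eq_single_of_mem (Fin.last n) (Finset.mem_univ _)
    (fun k _ hk => by rw [Pi.single_eq_of_ne hk, map_zero, mul_zero]) (f := fun k : Fin (n + 1) =>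
      chain (n + 1) k * incl n ((Pi.single (Fin.last n) 1 : Fin (n + 1) → HeckeAlgebra n) k)),
    Pi.single_eq_same, chain_top (by simp), map_one, mul_one, mul_one] at h
  exact h.symm

/-- `H_{n+1}(z) = H_n(z) + H_n(z) σ n H_n(z)`. -/
theorem hecke_induction_succ {n : ℕ} {p : HeckeAlgebra (n + 1) → Prop} (x : HeckeAlgebra (n + 1))
    (h0 : ∀ a, p (incl n a))
    (h1 : ∀ a b, 0 < n → p (incl n a * gen (n + 1) n * incl n b))
    (hadd : ∀ x y, p x → p y → p (x + y)) : p x := by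
  have hchain : ∀ d k, k + d = n → 0 < d → ∃ a, chain (n + 1) k = incl n a * gen (n + 1) n := by
    intro d
    induction d with
    | zero => intro k _ h; omega
    | succ d ih =>
      intro k hk _
      rcases Nat.eq_zero_or_pos d with rfl | hd
      · refine ⟨1, ?_⟩
        rw [chain_step (by omega), chain_top (by omega), map_one, one_mul, mul_one]
        congr 1
      · obtain ⟨a, ha⟩ := ih (k + 1) (by omega) hd
        refine ⟨gen n (k + 1) * a, ?_⟩
        rw [chain_step (by omega), ha, map_mul, incl_gen (by omega), mul_assoc]
  rw [eq_sum_cosetCoord x]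
  refine Finset.sum_induction _ p hadd (by simpa using h0 0) fun k _ => ?_
  rcases eq_or_ne k.1 n with hk | hk
  · rw [chain_top (by omega), one_mul]; exact h0 _
  · obtain ⟨a, ha⟩ := hchain (n - k) k (by omega) (by omega)
    rw [ha]; exact h1 _ _ (by omega)

theorem partialTrace₁_eq {n : ℕ} (x : HeckeAlgebra (n + 1)) :
    partialTrace₁ n x = ∑ k : Fin n, chain n k * cosetCoord n x k.castSucc := by
  simp [partialTrace₁]

theorem partialTrace₀_mul_incl {n : ℕ} (x : HeckeAlgebra (n + 1)) (b : HeckeAlgebra n) :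
    partialTrace₀ n (x * incl n b) = partialTrace₀ n x * b := by
  change cosetCoord n _ _ = cosetCoord n _ _ * b
  rw [cosetCoord_mul_incl]

theorem partialTrace₁_mul_incl {n : ℕ} (x : HeckeAlgebra (n + 1)) (b : HeckeAlgebra n) :
    partialTrace₁ n (x * incl n b) = partialTrace₁ n x * b := by
  simp only [partialTrace₁_eq, cosetCoord_mul_incl, Finset.sum_mul, mul_assoc]

theorem partialTrace₀_incl_mul {n : ℕ} (a : HeckeAlgebra n) (x : HeckeAlgebra (n + 1)) :
    partialTrace₀ n (incl n a * x) = a * partialTrace₀ n x := by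
  induction a using hecke_induction generalizing x with
  | hr r => rw [AlgHom.commutes, ← Algebra.smul_def, ← Algebra.smul_def, map_smul]
  | hadd a b ha hb => rw [map_add, add_mul, map_add, ha, hb, add_mul]
  | hmul a b ha hb => rw [map_mul (incl n), mul_assoc, ha, hb, mul_assoc]
  | hg i h h' =>
    change cosetCoord n _ _ = _ * cosetCoord n _ _
    rw [incl_gen h', cosetCoord_mul, cosetRep_gen h (by omega)]
    exact genAct_gt _ _ h'

theorem partialTrace₁_incl_mul {n : ℕ} (a : HeckeAlgebra n) (x : HeckeAlgebra (n + 1)) :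
    partialTrace₁ n (incl n a * x) = a * partialTrace₁ n x := by
  induction a using hecke_induction generalizing x with
  | hr r => rw [AlgHom.commutes, ← Algebra.smul_def, ← Algebra.smul_def, map_smul]
  | hadd a b ha hb => rw [map_add, add_mul, map_add, ha, hb, add_mul]
  | hmul a b ha hb => rw [map_mul (incl n), mul_assoc, ha, hb, mul_assoc]
  | hg i h h' =>
    obtain ⟨i, rfl⟩ : ∃ k, i = k + 1 := ⟨i - 1, by omega⟩
    let c : ℕ → HeckeAlgebra n := fun k => if k < n then chain n k else 0
    have hc : ∀ k, k < n → c k = chain n k := fun k hk => if_pos hk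
    have hc0 : ∀ k, ¬ k < n → c k = 0 := fun k hk => if_neg hk
    have hsum : ∀ f : Fin (n + 1) → HeckeAlgebra n, ∑ k : Fin n, chain n k * f k.castSucc =
        ∑ k : Fin (n + 1), c k * AlgHom.id ℤ[X] _ (f k) := fun f => by
      rw [Fin.sum_univ_castSucc, hc0 _ (by simp), zero_mul, add_zero]
      refine Finset.sum_congr rfl fun k _ => ?_
      rw [hc _ (by simp)]
      rfl
    rw [partialTrace₁_eq, partialTrace₁_eq, incl_gen h', cosetCoord_mul,
      cosetRep_gen h (by omega), hsum, hsum]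
    refine sum_genAct (AlgHom.id ℤ[X] _) c _ (by omega) ?_ ?_ ?_ ?_ _
    · rw [hc _ h', hc _ (by omega), chain_step h']
    · rw [hc _ h', hc _ (by omega), chain_step h', ← mul_assoc, gen_sq h h', add_mul, one_mul,
        smul_mul_assoc]
    · intro k hk _
      by_cases hkn : k < n
      · rw [hc _ hkn, gen_chain_gt hk]; rfl
      · rw [hc0 _ hkn, mul_zero, zero_mul]
    · intro k hk
      rw [hc _ (by omega), gen_chain_lt hk h']; rfl

theorem partialTrace₀_incl {n : ℕ} (a : HeckeAlgebra n) : partialTrace₀ n (incl n a) = a := by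
  change cosetCoord n _ _ = _
  rw [cosetCoord_incl, Pi.single_eq_same]

theorem partialTrace₁_incl {n : ℕ} (a : HeckeAlgebra n) : partialTrace₁ n (incl n a) = 0 := by
  rw [partialTrace₁_eq, cosetCoord_incl]
  refine Finset.sum_eq_zero fun k _ => ?_
  rw [Pi.single_eq_of_ne (Fin.castSucc_ne_last k), mul_zero]

theorem partialTrace₀_gen {n : ℕ} (h : 0 < n) : partialTrace₀ n (gen (n + 1) n) = 0 := by
  obtain ⟨n, rfl⟩ : ∃ k, n = k + 1 := ⟨n - 1, by omega⟩
  change cosetCoord (n + 1) _ _ = _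
  rw [cosetCoord_gen, Pi.single_eq_of_ne (Fin.castSucc_ne_last _).symm]

theorem partialTrace₁_gen {n : ℕ} (h : 0 < n) : partialTrace₁ n (gen (n + 1) n) = 1 := by
  obtain ⟨n, rfl⟩ : ∃ k, n = k + 1 := ⟨n - 1, by omega⟩
  rw [partialTrace₁_eq, cosetCoord_gen, Finset.sum_eq_single_of_mem (Fin.last n)
    (Finset.mem_univ _), Pi.single_eq_same, mul_one, chain_top (by simp)]
  intro k _ hk
  rw [Pi.single_eq_of_ne (by simpa [Fin.ext_iff] using hk), mul_zero]

theorem partialTrace_conj {n : ℕ} (b : HeckeAlgebra (n + 1)) :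
    partialTrace₀ (n + 1) (gen (n + 2) (n + 1) * incl (n + 1) b * gen (n + 2) (n + 1)) =
        incl n (partialTrace₀ n b) ∧
      partialTrace₁ (n + 1) (gen (n + 2) (n + 1) * incl (n + 1) b * gen (n + 2) (n + 1)) =
        (X : ℤ[X]) • b + incl n (partialTrace₁ n b) := by
  have hcomm : ∀ c : HeckeAlgebra n, gen (n + 2) (n + 1) * incl (n + 1) (incl n c) =
      incl (n + 1) (incl n c) * gen (n + 2) (n + 1) := by
    intro c
    induction c using hecke_induction with
    | hr r => rw [AlgHom.commutes, AlgHom.commutes, Algebra.commutes]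
    | hadd a b ha hb => rw [map_add, map_add, mul_add, add_mul, ha, hb]
    | hmul a b ha hb => rw [map_mul, map_mul, ← mul_assoc, ha, mul_assoc, hb, mul_assoc]
    | hg i h h' => rw [incl_gen h', incl_gen (by omega), ← gen_comm (by omega)]
  induction b using hecke_induction_succ with
  | h0 c =>
    rw [hcomm, mul_assoc, gen_sq (by omega) (by omega), partialTrace₀_incl_mul,
      partialTrace₁_incl_mul, map_add, map_add, map_smul, map_smul, partialTrace₀_gen (by omega),
      partialTrace₁_gen (by omega), ← map_one (incl (n + 1)), partialTrace₀_incl,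
      partialTrace₁_incl, partialTrace₀_incl, partialTrace₁_incl]
    simp
  | h1 c d hn =>
    have e : gen (n + 2) (n + 1) * incl (n + 1) (incl n c * gen (n + 1) n * incl n d) *
        gen (n + 2) (n + 1) = incl (n + 1) (incl n c * gen (n + 1) n) * gen (n + 2) (n + 1) *
          incl (n + 1) (gen (n + 1) n * incl n d) := by
      simp only [map_mul]
      rw [incl_gen (i := n) (by omega)]
      have hb := gen_braid (n := n + 2) (i := n)
      have hc := hcomm c
      have hd := hcomm d
      generalize incl (n + 1) (incl n c) = C at *
      generalize incl (n + 1) (incl n d) = D at *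
      generalize gen (n + 2) (n + 1) = S at *
      generalize gen (n + 2) n = G at *
      calc S * (C * G * D) * S = S * C * G * (D * S) := by simp only [mul_assoc]
        _ = C * S * G * (S * D) := by rw [hc, hd]
        _ = C * (S * G * S) * D := by simp only [mul_assoc]
        _ = C * (G * S * G) * D := by rw [hb]
        _ = C * G * S * (G * D) := by simp only [mul_assoc]
    rw [e, partialTrace₀_mul_incl, partialTrace₁_mul_incl, partialTrace₀_incl_mul,
      partialTrace₁_incl_mul, partialTrace₀_mul_incl, partialTrace₁_mul_incl,
      partialTrace₀_incl_mul, partialTrace₁_incl_mul, partialTrace₀_gen (by omega),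
      partialTrace₁_gen (by omega), partialTrace₀_gen hn, partialTrace₁_gen hn]
    refine ⟨by simp, ?_⟩
    rw [mul_one, mul_one, mul_assoc, ← mul_assoc (gen (n + 1) n), gen_sq hn (by omega), add_mul,
      mul_add, one_mul, smul_mul_assoc, mul_smul_comm, map_mul, mul_assoc]
  | hadd x y hx hy =>
    simp only [map_add, mul_add, add_mul, hx.1, hx.2, hy.1, hy.2, smul_add, true_and]
    abel

theorem ocneanuTrace_succ {n : ℕ} (x : HeckeAlgebra (n + 1)) :
    ocneanuTrace (n + 1) x =
      ocneanuTrace n (partialTrace₀ n x) + X * ocneanuTrace n (partialTrace₁ n x) := rfl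

/-- Stabilization: `Tr a` does not change when an unused strand is added. -/
theorem ocneanuTrace_incl {n : ℕ} (a : HeckeAlgebra n) :
    ocneanuTrace (n + 1) (incl n a) = ocneanuTrace n a := by
  rw [ocneanuTrace_succ, partialTrace₀_incl, partialTrace₁_incl, map_zero, mul_zero, add_zero]

/-- Normalization: `Tr 1 = 1`. -/
theorem ocneanuTrace_one (n : ℕ) : ocneanuTrace n 1 = 1 := by
  induction n with
  | zero => exact map_one (genLift (n := 0) (A := ℤ[X][X]) _ _ _ _)
  | succ n ih => rw [← map_one (incl n), ocneanuTrace_incl, ih]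

/-- The Markov property: `Tr (a σ n b) = T Tr (a b)` for `a b ∈ H_n(z)`. -/
theorem ocneanuTrace_markov {n : ℕ} (h : 0 < n) (a b : HeckeAlgebra n) :
    ocneanuTrace (n + 1) (incl n a * gen (n + 1) n * incl n b) =
      X * ocneanuTrace n (a * b) := by
  rw [ocneanuTrace_succ, partialTrace₀_mul_incl, partialTrace₀_incl_mul, partialTrace₁_mul_incl,
    partialTrace₁_incl_mul, partialTrace₀_gen h, partialTrace₁_gen h]
  simp

/-- The trace property: `Tr (x y) = Tr (y x)`. -/
theorem ocneanuTrace_comm {n : ℕ} (x y : HeckeAlgebra n) :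
    ocneanuTrace n (x * y) = ocneanuTrace n (y * x) := by
  induction n with
  | zero =>
    change genLift (n := 0) (A := ℤ[X][X]) _ _ _ _ _ = genLift (n := 0) (A := ℤ[X][X]) _ _ _ _ _
    rw [map_mul, map_mul, mul_comm]
  | succ n ih =>
    induction y using hecke_induction generalizing x with
    | hr r => rw [Algebra.commutes]
    | hadd a b ha hb => rw [mul_add, add_mul, map_add, map_add, ha, hb]
    | hmul a b ha hb => rw [← mul_assoc, hb, ← mul_assoc, ha, mul_assoc]
    | hg i h h' =>
      rcases Nat.lt_or_ge i n with hi | hi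
      · rw [← incl_gen hi, ocneanuTrace_succ, ocneanuTrace_succ, partialTrace₀_mul_incl,
          partialTrace₀_incl_mul, partialTrace₁_mul_incl, partialTrace₁_incl_mul, ih,
          ih (partialTrace₁ n x)]
      · obtain rfl : i = n := by omega
        obtain ⟨n, rfl⟩ : ∃ k, i = k + 1 := ⟨i - 1, by omega⟩
        induction x using hecke_induction_succ with
        | h0 a =>
          have h1 := ocneanuTrace_markov h a 1
          have h2 := ocneanuTrace_markov h 1 a
          rw [map_one, mul_one, mul_one] at h1
          rw [map_one, one_mul, one_mul] at h2
          rw [h1, h2]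
        | h1 a b _ =>
          have e1 : incl (n + 1) a * gen (n + 2) (n + 1) * incl (n + 1) b * gen (n + 2) (n + 1) =
              incl (n + 1) a * (gen (n + 2) (n + 1) * incl (n + 1) b * gen (n + 2) (n + 1)) := by
            simp only [mul_assoc]
          have e2 : gen (n + 2) (n + 1) * (incl (n + 1) a * gen (n + 2) (n + 1) *
              incl (n + 1) b) =
              gen (n + 2) (n + 1) * incl (n + 1) a * gen (n + 2) (n + 1) * incl (n + 1) b := by
            simp only [mul_assoc]
          rw [e1, e2, ocneanuTrace_succ (n := n + 1), ocneanuTrace_succ (n := n + 1), partialTrace₀_incl_mul,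
            partialTrace₁_incl_mul, partialTrace₀_mul_incl, partialTrace₁_mul_incl,
            (partialTrace_conj a).1, (partialTrace_conj a).2, (partialTrace_conj b).1,
            (partialTrace_conj b).2, mul_add, add_mul, mul_smul_comm, smul_mul_assoc,
            map_add, map_add, ocneanuTrace_succ (a * incl n _),
            ocneanuTrace_succ (a * incl n _), ocneanuTrace_succ (incl n _ * b),
            ocneanuTrace_succ (incl n _ * b)]
          simp only [partialTrace₀_incl_mul, partialTrace₁_incl_mul, partialTrace₀_mul_incl,
            partialTrace₁_mul_incl]
          ring
        | hadd x y hx hy => rw [add_mul, mul_add, map_add, map_add, hx, hy]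

/-- The usual characterization of Ocneanu's trace, as a family of functionals on all `H_n(z)`. -/
structure IsOcneanuTrace (t : (n : ℕ) → HeckeAlgebra n →ₗ[ℤ[X]] ℤ[X][X]) : Prop where
  one : ∀ n, t n 1 = 1
  comm : ∀ n (x y : HeckeAlgebra n), t n (x * y) = t n (y * x)
  stable : ∀ n (a : HeckeAlgebra n), t (n + 1) (incl n a) = t n a
  markov : ∀ n, 0 < n → ∀ a : HeckeAlgebra n,
    t (n + 1) (incl n a * gen (n + 1) n) = X * t n a

/-- `ocneanuTrace` is the one and only family with the characteristic properties. -/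
theorem isOcneanuTrace_iff (t : (n : ℕ) → HeckeAlgebra n →ₗ[ℤ[X]] ℤ[X][X]) :
    IsOcneanuTrace t ↔ t = ocneanuTrace := by
  constructor
  · intro h
    funext n
    induction n with
    | zero =>
      refine LinearMap.ext fun x => ?_
      have hx : ∃ r : ℤ[X], x = algebraMap ℤ[X] _ r := by
        induction x using hecke_induction with
        | hr r => exact ⟨r, rfl⟩
        | hadd x y hx hy =>
          obtain ⟨r, rfl⟩ := hx
          obtain ⟨s, rfl⟩ := hy
          exact ⟨r + s, (map_add _ _ _).symm⟩
        | hmul x y hx hy =>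
          obtain ⟨r, rfl⟩ := hx
          obtain ⟨s, rfl⟩ := hy
          exact ⟨r * s, (map_mul _ _ _).symm⟩
        | hg i h h' => omega
      obtain ⟨r, rfl⟩ := hx
      rw [Algebra.algebraMap_eq_smul_one, map_smul, map_smul, h.one, ocneanuTrace_one]
    | succ n ih =>
      refine LinearMap.ext fun x => ?_
      induction x using hecke_induction_succ with
      | h0 a => rw [h.stable, ocneanuTrace_incl, ih]
      | h1 a b hn =>
        rw [ocneanuTrace_markov hn, h.comm, ← mul_assoc, ← map_mul, h.markov n hn, ih,
          ocneanuTrace_comm]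
      | hadd x y hx hy => rw [map_add, map_add, hx, hy]
  · rintro rfl
    refine ⟨ocneanuTrace_one, fun n => ocneanuTrace_comm, fun n => ocneanuTrace_incl,
      fun n hn a => ?_⟩
    have h := ocneanuTrace_markov hn a 1
    rwa [map_one, mul_one, mul_one] at h

/-! ## The framed Homfly polynomial

It is a Laurent polynomial in `v` over `ℤ[z, z⁻¹]`. The substitution `T = z / (1 - v²)` takes place
in the ring of formal Laurent series in `v` over `ℤ[z, z⁻¹]`, where `1 - v²` is a unit. -/

/-- Formal Laurent series in `v` over `ℤ[z, z⁻¹]`. -/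
abbrev VSeries : Type := LaurentSeries (LaurentPolynomial ℤ)

/-- The variable `v`. -/
noncomputable def v : VSeries := HahnSeries.single 1 1

/-- The inverse of `v`. -/
noncomputable def vInv : VSeries := HahnSeries.single (-1) 1

/-- The variable `z`. -/
noncomputable def z : VSeries := HahnSeries.C (LaurentPolynomial.T 1)

/-- The inverse of `z`. -/
noncomputable def zInv : VSeries := HahnSeries.C (LaurentPolynomial.T (-1))

theorem v_mul_vInv : v * vInv = 1 := by
  rw [v, vInv, HahnSeries.single_mul_single]
  simp

theorem z_mul_zInv : z * zInv = 1 := by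
  rw [z, zInv, ← map_mul, ← LaurentPolynomial.T_add]
  simp

theorem isUnit_one_sub_v_sq : IsUnit (1 - v ^ 2) := by
  have h : IsUnit (1 - PowerSeries.X ^ 2 : PowerSeries (LaurentPolynomial ℤ)) := by
    rw [PowerSeries.isUnit_iff_constantCoeff]
    simp
  have h' := h.map (HahnSeries.ofPowerSeries ℤ (LaurentPolynomial ℤ))
  rwa [map_sub, map_one, map_pow, HahnSeries.ofPowerSeries_X] at h'

/-- The substitution `T = z / (1 - v²)`, from `ℤ[z][T]`. -/
noncomputable def substT : ℤ[X][X] →+* VSeries :=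
  eval₂RingHom (eval₂RingHom (Int.castRingHom VSeries) z) (z * Ring.inverse (1 - v ^ 2))

/-- The framed Homfly polynomial `H(v, z) = ((v⁻¹ - v) / z)^(n-1) Tr |_{T = z / (1 - v²)}`,
as a functional on the Hecke algebra. -/
noncomputable def framedHomfly (n : ℕ) (x : HeckeAlgebra n) : VSeries :=
  ((vInv - v) * zInv) ^ (n - 1) * substT (ocneanuTrace n x)

theorem substT_C (r : ℤ[X]) :
    substT (C r) = HahnSeries.C (algebraMap ℤ[X] (LaurentPolynomial ℤ) r) := by
  have h : substT.comp C = (HahnSeries.C : LaurentPolynomial ℤ →+* VSeries).comp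
      (algebraMap ℤ[X] (LaurentPolynomial ℤ)) := by
    refine Polynomial.ringHom_ext' (Subsingleton.elim _ _) ?_
    simp [substT, z, LaurentPolynomial.algebraMap_eq_toLaurent]
  exact congrArg (fun f => f r) h

theorem framedHomfly_add {n : ℕ} (x y : HeckeAlgebra n) :
    framedHomfly n (x + y) = framedHomfly n x + framedHomfly n y := by
  rw [framedHomfly, map_add, map_add, mul_add]; rfl

theorem framedHomfly_smul {n : ℕ} (r : ℤ[X]) (x : HeckeAlgebra n) :
    framedHomfly n (r • x) =
      HahnSeries.C (algebraMap ℤ[X] (LaurentPolynomial ℤ) r) * framedHomfly n x := by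
  rw [framedHomfly, map_smul, Polynomial.smul_eq_C_mul, map_mul, substT_C, mul_left_comm]; rfl

/-- The set of exponents of `v` that occur in the framed Homfly polynomial of a braid. -/
def vExponents (n : ℕ) (β : BraidGroup n) : Set ℤ :=
  {k | (framedHomfly n (toHecke n β)).coeff k ≠ 0}

/-- The lower Morton–Franks–Williams estimate, `1 - n ≤` any exponent of `v`, is sharp. -/
def LowerMFWSharp (n : ℕ) (β : BraidGroup n) : Prop :=
  IsLeast (vExponents n β) (1 - (n : ℤ))

/-- The upper Morton–Franks–Williams estimate, any exponent of `v` is `≤ n - 1`, is sharp. -/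
def UpperMFWSharp (n : ℕ) (β : BraidGroup n) : Prop :=
  IsGreatest (vExponents n β) ((n : ℤ) - 1)

/-! ## The inner products -/

/-- The reversal `β ↦ β*` of braid words, as a homomorphism to the opposite group. -/
def braidRev (n : ℕ) : BraidGroup n →* (BraidGroup n)ᵐᵒᵖ :=
  braidLift (fun i => MulOpposite.op (σ i))
    (fun i j h => by rw [← MulOpposite.op_mul, ← MulOpposite.op_mul, σ_comm i j h])
    (fun i j h => by
      simp only [← MulOpposite.op_mul, ← mul_assoc]
      rw [σ_braid i j h])

/-- The linear extension of the reversal `β ↦ β*` to the Hecke algebra. -/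
noncomputable def heckeRev (n : ℕ) : HeckeAlgebra n →ₗ[ℤ[X]] HeckeAlgebra n :=
  (MulOpposite.opLinearEquiv ℤ[X]).symm.toLinearMap ∘ₗ
    (heckeLift ((toHecke n).op.comp (braidRev n)) (fun i => by
      rw [MonoidHom.comp_apply, MonoidHom.comp_apply, map_inv, braidRev, braidLift_σ]
      exact congrArg MulOpposite.op (toHecke_skein i)) :
        HeckeAlgebra n →ₐ[ℤ[X]] (HeckeAlgebra n)ᵐᵒᵖ).toLinearMap

theorem heckeRev_toHecke {n : ℕ} (β : BraidGroup n) :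
    heckeRev n (toHecke n β) = toHecke n (braidRev n β).unop := by
  simp [heckeRev]

/-- The left column `L = z^(n-1)` times the coefficient of `v^(1-n)` in `H`. -/
noncomputable def leftColumn (n : ℕ) : HeckeAlgebra n →ₗ[ℤ[X]] LaurentPolynomial ℤ where
  toFun x := LaurentPolynomial.T 1 ^ (n - 1) * (framedHomfly n x).coeff (1 - (n : ℤ))
  map_add' x y := by rw [framedHomfly_add, HahnSeries.coeff_add, mul_add]
  map_smul' r x := by
    rw [framedHomfly_smul, HahnSeries.C_mul_eq_smul, HahnSeries.coeff_smul, smul_eq_mul,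
      mul_left_comm, RingHom.id_apply, Algebra.smul_def]

/-- The right column, `(-z)^(n-1)` times the coefficient of `v^(n-1)` in `H`. -/
noncomputable def rightColumn (n : ℕ) : HeckeAlgebra n →ₗ[ℤ[X]] LaurentPolynomial ℤ where
  toFun x := (-LaurentPolynomial.T 1) ^ (n - 1) * (framedHomfly n x).coeff ((n : ℤ) - 1)
  map_add' x y := by rw [framedHomfly_add, HahnSeries.coeff_add, mul_add]
  map_smul' r x := by
    rw [framedHomfly_smul, HahnSeries.C_mul_eq_smul, HahnSeries.coeff_smul, smul_eq_mul,
      mul_left_comm, RingHom.id_apply, Algebra.smul_def]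

/-- The left inner product `⟨x, y⟩ = L (x y*)` on the Hecke algebra. -/
noncomputable def leftInner (n : ℕ) :
    HeckeAlgebra n →ₗ[ℤ[X]] HeckeAlgebra n →ₗ[ℤ[X]] LaurentPolynomial ℤ :=
  ((LinearMap.mul ℤ[X] (HeckeAlgebra n)).compl₂ (heckeRev n)).compr₂ (leftColumn n)

/-- The right inner product on the Hecke algebra. -/
noncomputable def rightInner (n : ℕ) :
    HeckeAlgebra n →ₗ[ℤ[X]] HeckeAlgebra n →ₗ[ℤ[X]] LaurentPolynomial ℤ :=
  ((LinearMap.mul ℤ[X] (HeckeAlgebra n)).compl₂ (heckeRev n)).compr₂ (rightColumn n)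

theorem leftInner_braid {n : ℕ} (α β : BraidGroup n) :
    leftInner n (toHecke n α) (toHecke n β) =
      LaurentPolynomial.T 1 ^ (n - 1) *
        (framedHomfly n (toHecke n (α * (braidRev n β).unop))).coeff (1 - (n : ℤ)) := by
  rw [map_mul, ← heckeRev_toHecke]
  rfl

theorem rightInner_braid {n : ℕ} (α β : BraidGroup n) :
    rightInner n (toHecke n α) (toHecke n β) =
      (-LaurentPolynomial.T 1) ^ (n - 1) *
        (framedHomfly n (toHecke n (α * (braidRev n β).unop))).coeff ((n : ℤ) - 1) := by
  rw [map_mul, ← heckeRev_toHecke]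
  rfl

end BraidHecke

/-! Sharpness of an MFW estimate involves two conditions: the extreme power of `v` occurs, and no
exponent lies beyond it. The second always holds, by the Morton–Franks–Williams inequalities, so
sharpness says exactly that the coefficient of `v^(1-n)`, resp. `v^(n-1)`, in the framed Homfly
polynomial is nonzero. The inner product with the unit braid is that same coefficient multiplied by
`z^(n-1)`, resp. `(-z)^(n-1)`. These factors are units of `ℤ[z, z⁻¹]`, so one vanishes exactly when
the other does.

The substance is therefore the inequalities. Put `m = n - 1`. Since `H_{n+1} = H_n + H_n σ_n H_n`,
the Markov property raises the `T`-degree of the trace by at most one for each new strand beyond the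
first, so the degree on `n` strands is at most `m` (`natDegree_ocneanuTrace_le`). Because `v⁻¹ - v =
v⁻¹ (1 - v²)`, the prefactor `((v⁻¹ - v)/z)^m` contains enough factors `1 - v²` to clear the
denominator of every `T^k = (z/(1 - v²))^k` with `k ≤ m`. What remains is `z^(k-m) v^(-m) (1 -
v²)^(m-k)` (`homfly_term`), a Laurent polynomial with exponents of `v` from `-m` to `m - 2k`. The
coefficients of the trace do not involve `v`, so summing over `k` gives `exponentsIn_framedHomfly`.

The same formula explains the normalizations: all `k` contribute to the left column, which is the
trace at `T = z`, while only `k = 0` reaches `v^m`, so the right column is the trace at `T = 0`. -/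

namespace BraidHecke

/-! ### Degree of Ocneanu's trace in `T` -/

/-- In `H_n(z)`, `n ≥ 1`, Ocneanu's trace has degree at most `n - 1` in `T`. -/
theorem natDegree_ocneanuTrace_le (n : ℕ) (x : HeckeAlgebra n) :
    (ocneanuTrace n x).natDegree ≤ n - 1 := by
  induction n with
  | zero =>
    -- With no generators, the algebra on `0` strands consists of scalars. The bound `0 - 1` is
    -- truncated to `0`, which is the degree bound for a constant.
    have hx : ∃ r : ℤ[X], x = algebraMap ℤ[X] _ r := by
      induction x using hecke_induction with
      | hr r => exact ⟨r, rfl⟩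
      | hadd x y hx hy =>
        obtain ⟨r, rfl⟩ := hx
        obtain ⟨s, rfl⟩ := hy
        exact ⟨r + s, (map_add _ _ _).symm⟩
      | hmul x y hx hy =>
        obtain ⟨r, rfl⟩ := hx
        obtain ⟨s, rfl⟩ := hy
        exact ⟨r * s, (map_mul _ _ _).symm⟩
      | hg i h h' => omega
    obtain ⟨r, rfl⟩ := hx
    rw [Algebra.algebraMap_eq_smul_one, map_smul, ocneanuTrace_one]
    exact (natDegree_smul_le r 1).trans (by simp)
  | succ n ih =>
    induction x using hecke_induction_succ with
    | h0 a => rw [ocneanuTrace_incl]; exact (ih a).trans (by omega)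
    | h1 a b hn =>
      -- The factor `T` adds one to the bound `n - 1`. Positivity of `n`, supplied by the induction
      -- principle, makes `1 + (n - 1)` equal to `n` despite truncated subtraction.
      rw [ocneanuTrace_markov hn]
      have := ih (a * b)
      exact (natDegree_mul_le_of_le natDegree_X_le this).trans (by omega)
    | hadd x y hx hy => rw [map_add]; exact natDegree_add_le_of_degree_le hx hy

/-! ### Calculus of two-sided bounds on the exponents of `v` -/

/-- All exponents of `v` in `s` lie between `a` and `b`. -/
def ExponentsIn (a b : ℤ) (s : VSeries) : Prop :=
  ∀ k, s.coeff k ≠ 0 → a ≤ k ∧ k ≤ b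

namespace ExponentsIn

variable {a b c d : ℤ} {s t : VSeries}

theorem mono (hs : ExponentsIn a b s) (hc : c ≤ a) (hd : b ≤ d) : ExponentsIn c d s :=
  fun k hk => ⟨hc.trans (hs k hk).1, (hs k hk).2.trans hd⟩

theorem zero : ExponentsIn a b 0 := fun _ hk => absurd HahnSeries.coeff_zero hk

theorem add (hs : ExponentsIn a b s) (ht : ExponentsIn a b t) : ExponentsIn a b (s + t) := by
  intro k hk
  by_cases h : s.coeff k = 0
  · exact ht k fun h' => hk (by rw [HahnSeries.coeff_add, h, h', add_zero])
  · exact hs k h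

theorem sum {ι : Type*} (I : Finset ι) {f : ι → VSeries} (h : ∀ i ∈ I, ExponentsIn a b (f i)) :
    ExponentsIn a b (∑ i ∈ I, f i) :=
  Finset.sum_induction f _ (fun _ _ => add) zero h

/-- A nonzero coefficient of the product needs at least one nonzero term in its convolution sum.
Only bounds are claimed, so cancellation among the terms is harmless. -/
theorem mul (hs : ExponentsIn a b s) (ht : ExponentsIn c d t) :
    ExponentsIn (a + c) (b + d) (s * t) := by
  intro k hk
  rw [HahnSeries.coeff_mul] at hk
  obtain ⟨⟨i, j⟩, hij, -⟩ := Finset.exists_ne_zero_of_sum_ne_zero hk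
  obtain ⟨hi, hj, rfl⟩ := Finset.mem_antidiagonal.1 hij
  have h1 := hs i hi
  have h2 := ht j hj
  exact ⟨add_le_add h1.1 h2.1, add_le_add h1.2 h2.2⟩

theorem single (a : ℤ) (r : LaurentPolynomial ℤ) : ExponentsIn a a (HahnSeries.single a r) := by
  intro k hk
  obtain rfl : k = a := by
    by_contra h
    exact hk (HahnSeries.coeff_single_of_ne h)
  exact ⟨le_rfl, le_rfl⟩

-- `HahnSeries.C` is by definition the monomial of exponent `0`.
theorem const (r : LaurentPolynomial ℤ) : ExponentsIn 0 0 (HahnSeries.C r) := single 0 r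

theorem pow (hs : ExponentsIn a b s) (m : ℕ) : ExponentsIn (m * a) (m * b) (s ^ m) := by
  induction m with
  | zero => simpa using const 1
  | succ m ih =>
    rw [pow_succ]
    exact (ih.mul hs).mono (by push_cast; linarith) (by push_cast; linarith)

end ExponentsIn

/-! ### Morton–Franks–Williams inequalities -/

/-- Bounding `1 - v²` itself suffices: its inverse, whose expansion has exponents unbounded above,
disappears from every summand of the framed Homfly polynomial. -/
theorem exponentsIn_one_sub_v_sq : ExponentsIn 0 2 (1 - v ^ 2) := by
  have h : (1 - v ^ 2 : VSeries) = HahnSeries.C 1 + HahnSeries.single 2 (-1) := by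
    rw [v, HahnSeries.single_pow, sub_eq_add_neg, map_one, HahnSeries.single_neg]
    simp
  rw [h]
  exact ((ExponentsIn.const 1).mono le_rfl (by norm_num)).add
    ((ExponentsIn.single 2 (-1)).mono (by norm_num) le_rfl)

theorem substT_X : substT X = z * Ring.inverse (1 - v ^ 2) := by
  simp [substT]

/-- The summand of the framed Homfly polynomial contributed by `T ^ k`, `k ≤ m = n - 1`. -/
theorem homfly_term {m k : ℕ} (hk : k ≤ m) :
    ((vInv - v) * zInv) ^ m * (z * Ring.inverse (1 - v ^ 2)) ^ k =
      HahnSeries.C (LaurentPolynomial.T (-1)) ^ (m - k) * (vInv ^ m * (1 - v ^ 2) ^ (m - k)) := by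
  -- Of the `k + j` factors of the prefactor, `k` are spent on cancelling `T ^ k`, and `j = m - k`
  -- survive.
  obtain ⟨j, rfl⟩ := Nat.exists_eq_add_of_le hk
  have h1 : vInv - v = vInv * (1 - v ^ 2) := by
    linear_combination v * v_mul_vInv
  have h2 := Ring.mul_inverse_cancel _ isUnit_one_sub_v_sq
  -- One factor `T` against one factor of the prefactor, up to `v⁻¹`: `(1 - v²)/z · z/(1 - v²) = 1`.
  have h3 : zInv * (1 - v ^ 2) * (z * Ring.inverse (1 - v ^ 2)) = 1 := by
    linear_combination z * zInv * h2 + z_mul_zInv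
  rw [h1, Nat.add_sub_cancel_left, ← zInv]
  calc (vInv * (1 - v ^ 2) * zInv) ^ (k + j) * (z * Ring.inverse (1 - v ^ 2)) ^ k
      = vInv ^ (k + j) * (zInv * (1 - v ^ 2)) ^ j *
          (zInv * (1 - v ^ 2) * (z * Ring.inverse (1 - v ^ 2))) ^ k := by
        rw [mul_assoc, mul_comm (1 - v ^ 2) zInv, mul_pow, mul_pow _ (z * _), pow_add _ k j]
        ring
    _ = _ := by rw [h3, one_pow, mul_pow]; ring

/-- The Morton–Franks–Williams inequalities. -/
theorem exponentsIn_framedHomfly {n : ℕ} (hn : 1 ≤ n) (x : HeckeAlgebra n) :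
    ExponentsIn (1 - n) (n - 1) (framedHomfly n x) := by
  obtain ⟨m, rfl⟩ := Nat.exists_eq_add_of_le' hn
  have hdeg := natDegree_ocneanuTrace_le (m + 1) x
  -- The trace is expanded in powers `T ^ k` with `k ≤ m`; the degree bound guarantees that no other
  -- powers occur.
  rw [framedHomfly, Polynomial.as_sum_range' _ (m + 1) (Nat.lt_succ_of_le hdeg), map_sum,
    Finset.mul_sum]
  refine ExponentsIn.sum _ fun k hk => ?_
  have hkm : k ≤ m := Nat.le_of_lt_succ (Finset.mem_range.1 hk)
  rw [← Polynomial.C_mul_X_pow_eq_monomial, map_mul, map_pow, substT_C, substT_X, mul_left_comm,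
    Nat.add_sub_cancel, homfly_term hkm]
  -- The two factors constant in `v` contribute exponent `0`, the power of `v⁻¹` contributes `-m`,
  -- and the power of `1 - v²` contributes between `0` and `2(m - k)`. The total lies between `-m`
  -- and `m - 2k`, and `m - 2k ≤ m`.
  refine ((ExponentsIn.const _).mul (((ExponentsIn.const _).pow _).mul
    (((ExponentsIn.single (-1) 1).pow m).mul (exponentsIn_one_sub_v_sq.pow (m - k))))).mono ?_ ?_
  · push_cast; linarith
  · push_cast [Nat.cast_sub hkm]; linarith [Int.natCast_nonneg k]

/-! ### Sharpness as nonvanishing of an extreme coefficient -/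

/-- Being a lower bound of the exponents is automatic by `exponentsIn_framedHomfly`, so `IsLeast`
reduces to membership, that is, to nonvanishing of the coefficient. The upper case is symmetric. -/
theorem lowerMFWSharp_iff {n : ℕ} (hn : 1 ≤ n) (β : BraidGroup n) :
    LowerMFWSharp n β ↔ (framedHomfly n (toHecke n β)).coeff (1 - (n : ℤ)) ≠ 0 :=
  ⟨fun h => h.1, fun h => ⟨h, fun k hk => (exponentsIn_framedHomfly hn _ k hk).1⟩⟩

theorem upperMFWSharp_iff {n : ℕ} (hn : 1 ≤ n) (β : BraidGroup n) :
    UpperMFWSharp n β ↔ (framedHomfly n (toHecke n β)).coeff ((n : ℤ) - 1) ≠ 0 :=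
  ⟨fun h => h.1, fun h => ⟨h, fun k hk => (exponentsIn_framedHomfly hn _ k hk).2⟩⟩

end BraidHecke

theorem mainTheorem2 (n : ℕ) (hn : 1 ≤ n) (β : BraidHecke.BraidGroup n) :
    (¬ BraidHecke.LowerMFWSharp n β ↔
        BraidHecke.leftInner n (BraidHecke.toHecke n β) (BraidHecke.toHecke n 1) = 0) ∧
      (¬ BraidHecke.UpperMFWSharp n β ↔
        BraidHecke.rightInner n (BraidHecke.toHecke n β) (BraidHecke.toHecke n 1) = 0) := by
  -- The variable `z` is invertible in `ℤ[z, z⁻¹]`, so the normalizing factors `z^(n-1)` and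
  -- `(-z)^(n-1)` cancel from an equation with right-hand side `0`. The reversal of the unit braid
  -- is the unit braid, so the column is evaluated at `β` itself.
  have hT : IsUnit (LaurentPolynomial.T 1 : LaurentPolynomial ℤ) := LaurentPolynomial.isUnit_T 1
  rw [BraidHecke.lowerMFWSharp_iff hn, BraidHecke.upperMFWSharp_iff hn, not_not, not_not,
    BraidHecke.leftInner_braid, BraidHecke.rightInner_braid, map_one, MulOpposite.unop_one,
    mul_one, (hT.pow (n - 1)).mul_right_eq_zero, (hT.neg.pow (n - 1)).mul_right_eq_zero]
  exact ⟨Iff.rfl, Iff.rfl⟩
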